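/- Signals are arbitrary sequences $x=(x(0),x(1),\dots)$ in $\mathbb{R}^n$, with $\|x\|_\infty=\sup_t\max_i|x_i(t)|\in[0,\infty]$ and truncations $P_Tx=(x(0),\dots,x(T),0,0,\dots)$. A linear operator $\mathbf H$ on signals is causal if $P_T\mathbf H=P_T\mathbf HP_T$ for all $T\ge 0$, and time-invariant if it commutes with the delay $x\mapsto(0,x(0),x(1),\dots)$. Its induced norm is $\|\mathbf H\|_1=\sup_T\sup_{x\neq0}\|P_T\mathbf Hx\|_\infty/\|P_Tx\|_\infty$ (with $0/0=0$), and $\mathbf H$ is $\ell_\infty$-stable if $\|\mathbf H\|_1<\infty$. Its elements $\mathbf H_{ij}$ are the scalar operators from channel $j$ to channel $i$. Let $\mathscr D$ be the set of $\ell_\infty$-stable causal linear (possibly time-varying) operators $\boldsymbol\Delta$ with $n$ inputs and outputs whose off-diagonal elements are zero, and write $\boldsymbol\delta_i=\boldsymbol\Delta_{ii}$. Let $\mathbf G$ be an $\ell_\infty$-stable, causal, linear time-invariant operator with $n$ inputs and outputs, let $M_G=(\|\mathbf G_{ij}\|_1)_{i,j=1}^n$ be its magnitude matrix, and define \[ \nu_{\mathscr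 D}(\mathbf G)=\frac{1}{\inf\left\{\sum_{i=1}^n\|\boldsymbol\delta_i\|_1:\ \boldsymbol\Delta\in\mathscr D,\ (I-\mathbf G\boldsymbol\Delta)^{-1}\text{ is unstable}\right\}}, \] where ``unstable'' means that $I-\mathbf G\boldsymbol\Delta$ has no causal $\ell_\infty$-stable two-sided inverse, $\inf\emptyset=\infty$ and $1/\infty=0$. Theorem. For every $m\ge1$ and every tuple $I=(i_1,\dots,i_m)$ of pairwise distinct indices in $\{1,\dots,n\}$, the $m\times m$ matrix $M_I=\big((M_G)_{i_ki_l}\big)_{k,l=1}^m$ satisfies \[ \nu_{\mathscr D}(\mathbf G)\ \ge\ \frac{\rho(M_I)}{m}, \] where $\rho$ denotes the spectral radius. -/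

import Mathlib

open scoped ENNReal

namespace RobustNu

/-- The extended signal space `ℓ_{∞,e}^n`: all sequences `x(0), x(1), …` in `ℝⁿ`
(every finite truncation of such a sequence is bounded). -/
abbrev Signal (n : ℕ) : Type := ℕ → Fin n → ℝ

/-- Linear operators on the extended signal space. -/
abbrev Op (n : ℕ) : Type := Signal n →ₗ[ℝ] Signal n

/-- The norm `‖x‖_∞ = max_i sup_t |x_i(t)|`, with value `∞` on unbounded signals. -/
noncomputable def supNorm {n : ℕ} (x : Signal n) : ℝ≥0∞ := ⨆ t, ⨆ i, ‖x t i‖ₑ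

/-- The truncation `P_T x = (x(0), …, x(T), 0, 0, …)`. -/
def trunc {n : ℕ} (T : ℕ) : Op n where
  toFun x := fun t => if t ≤ T then x t else 0
  map_add' x y := by
    funext t i
    by_cases h : t ≤ T <;> simp [h]
  map_smul' c x := by
    funext t i
    by_cases h : t ≤ T <;> simp [h]

/-- The delay (right shift) `z⁻¹ x = (0, x(0), x(1), …)`. -/
def delay {n : ℕ} : Op n where
  toFun x := fun t => if t = 0 then 0 else x (t - 1)
  map_add' x y := by
    funext t i
    by_cases h : t = 0 <;> simp [h]
  map_smul' c x := by
    funext t i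
    by_cases h : t = 0 <;> simp [h]

/-- Causality: `P_T H = P_T H P_T` for all `T`. -/
def IsCausal {n : ℕ} (H : Op n) : Prop :=
  ∀ T : ℕ, trunc T ∘ₗ H = trunc T ∘ₗ H ∘ₗ trunc T

/-- Time invariance: `H` commutes with the delay. -/
def IsTimeInvariant {n : ℕ} (H : Op n) : Prop := H ∘ₗ delay = delay ∘ₗ H

/-- The induced norm
`‖H‖₁ = ‖H‖_{∞,∞} = sup_T sup_{x ≠ 0} ‖P_T H x‖_∞ / ‖P_T x‖_∞`, a value in `[0, ∞]`.
If `P_T x = 0`, the quotient is `0` when `P_T H x = 0` (always so for causal `H`) and `∞`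
otherwise. -/
noncomputable def gain {n : ℕ} (H : Op n) : ℝ≥0∞ :=
  ⨆ T : ℕ, ⨆ x : Signal n, ⨆ _ : x ≠ 0, supNorm (trunc T (H x)) / supNorm (trunc T x)

/-- `ℓ_∞`-stability. -/
def IsStable {n : ℕ} (H : Op n) : Prop := gain H < ∞

/-- The scalar signal `u` placed in the `j`-th channel, zero in all other channels. -/
def channelIn {n : ℕ} (j : Fin n) : Signal 1 →ₗ[ℝ] Signal n where
  toFun u := fun t k => if k = j then u t 0 else 0
  map_add' u v := by
    funext t k
    by_cases h : k = j <;> simp [h]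
  map_smul' c u := by
    funext t k
    by_cases h : k = j <;> simp [h]

/-- The `i`-th channel of a signal. -/
def channelOut {n : ℕ} (i : Fin n) : Signal n →ₗ[ℝ] Signal 1 where
  toFun x := fun t _ => x t i
  map_add' _ _ := rfl
  map_smul' _ _ := rfl

/-- The `(i, j)` element `H_{ij}`, an operator on scalar signals. -/
def entry {n : ℕ} (H : Op n) (i j : Fin n) : Op 1 := channelOut i ∘ₗ H ∘ₗ channelIn j

/-- The magnitude matrix `(‖H_{ij}‖₁)_{ij}` of a stable operator. -/
noncomputable def magnitudeMatrix {n : ℕ} (H : Op n) : Matrix (Fin n) (Fin n) ℝ :=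
  Matrix.of fun i j => (gain (entry H i j)).toReal

/-- The spectral radius of a real square matrix: the largest modulus of its complex
eigenvalues. -/
noncomputable def rho {m : ℕ} (A : Matrix (Fin m) (Fin m) ℝ) : ℝ≥0∞ :=
  spectralRadius ℂ (A.map (fun a => (a : ℂ)))

/-- The uncertainties: `ℓ_∞`-stable causal linear (possibly time-varying) operators whose
off-diagonal elements are zero. -/
def diagonalUncertainty (n : ℕ) : Set (Op n) :=
  {Δ | IsCausal Δ ∧ IsStable Δ ∧ ∀ i j, i ≠ j → entry Δ i j = 0}

/-- `H` has a causal `ℓ_∞`-stable two-sided inverse on the extended signal space. -/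
def HasStableInverse {n : ℕ} (H : Op n) : Prop :=
  ∃ K : Op n, IsCausal K ∧ IsStable K ∧ K ∘ₗ H = LinearMap.id ∧ H ∘ₗ K = LinearMap.id

/-- `ν(G)`: the reciprocal of the infimum of `∑ᵢ ‖δᵢ‖₁` over the uncertainties `Δ` for which
`(I - GΔ)⁻¹` is unstable, with `inf ∅ = ∞` and `1 / ∞ = 0`. -/
noncomputable def nu {n : ℕ} (G : Op n) : ℝ≥0∞ :=
  1 / ⨅ Δ ∈ {Δ ∈ diagonalUncertainty n | ¬ HasStableInverse (LinearMap.id - G ∘ₗ Δ)},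
    ∑ i, gain (entry Δ i i)

end RobustNu

/-! For `r` below the spectral radius of `M_I`, the moduli of an eigenvector give a nonnegative `w ≠
0` with `M_I w ≥ b w` and `b > r`; let `v` be `w` extended by zero outside `I`. Since entries of `G`
have norm at most the `ℓ₁` norm of their impulse response, inputs with time-reversed matching signs
and amplitudes `v` nearly attain the gains `(M_G v) i`. `exists_growing_excitation` does this for
one channel per time block, raising the amplitude by `θ = a / r > 1` after each round (`r < a < b`),
so old inputs cannot spoil the response. Let `x` equal `G y` except for a seed at time 0. Each `y t
i` is at most `r⁻¹` times an earlier or current value of `x` in channel `i`, so a diagonal `Δ` of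
gain at most `r⁻¹` sends `x` to `y` (`exists_diagonal_interpolation`). Then `(I - GΔ) x` lives at
time 0 only while `x` is unbounded, so no stable inverse exists. At most `m` channels of `Δ` are
active, hence the infimum is at most `m / r`. -/

namespace RobustNu

open Finset Filter

variable {n : ℕ}

/-! ### Convolution representation -/

/-- The unit impulse at time `0` in channel `j`. -/
def impulse (j : Fin n) : Signal n := fun t l => if t = 0 ∧ l = j then 1 else 0

/-- The impulse response of `G` from channel `j` to channel `i`. -/
def impulseResponse (G : Op n) (i j : Fin n) (k : ℕ) : ℝ := G (impulse j) k i

lemma delay_pow_apply (s : ℕ) (x : Signal n) (t : ℕ) :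
    ((delay ^ s : Op n) x) t = if t < s then 0 else x (t - s) := by
  induction s generalizing t with
  | zero => simp
  | succ s ih =>
    rw [pow_succ']
    change (if t = 0 then 0 else ((delay ^ s : Op n) x) (t - 1)) = _
    rcases t with _ | t
    · simp
    · simp [ih]

lemma IsTimeInvariant.delay_pow {G : Op n} (h : IsTimeInvariant G) (s : ℕ) (x : Signal n) :
    G ((delay ^ s : Op n) x) = (delay ^ s : Op n) (G x) := by
  induction s with
  | zero => simp
  | succ s ih =>
    rw [pow_succ']
    change G (delay ((delay ^ s : Op n) x)) = delay ((delay ^ s : Op n) (G x))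
    rw [← ih]
    exact LinearMap.congr_fun h _

lemma trunc_eq_sum (T : ℕ) (x : Signal n) :
    trunc T x = ∑ s ∈ range (T + 1), ∑ j, x s j • (delay ^ s : Op n) (impulse j) := by
  funext t i
  simp only [Finset.sum_apply, Pi.smul_apply, smul_eq_mul, delay_pow_apply]
  have h : ∀ s, (∑ j, x s j * (if t < s then (0 : Fin n → ℝ) else impulse j (t - s)) i)
      = if s = t then x t i else 0 := by
    intro s
    by_cases h1 : t < s
    · simp [h1, h1.ne']
    · by_cases h2 : s = t
      · subst h2; simp [impulse]
      · have : t - s ≠ 0 := by omega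
        simp [h1, h2, impulse, this]
  simp only [h, Finset.sum_ite_eq', Finset.mem_range]
  by_cases h : t ≤ T <;> simp [trunc, h]

/-- A causal time-invariant operator is the convolution with its impulse response. -/
lemma apply_eq_convolution {G : Op n} (hc : IsCausal G) (hti : IsTimeInvariant G)
    (x : Signal n) (t : ℕ) (i : Fin n) :
    G x t i = ∑ j, ∑ k ∈ range (t + 1), impulseResponse G i j k * x (t - k) j := by
  have h1 : G x t = G (trunc t x) t := by
    have := congrFun (LinearMap.congr_fun (hc t) x) t
    simpa [trunc] using this
  -- By causality only a finite combination of shifted impulses matters, so linearity suffices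
  -- without continuity.
  rw [h1, trunc_eq_sum]
  simp only [map_sum, map_smul, hti.delay_pow, Finset.sum_apply, Pi.smul_apply, smul_eq_mul,
    delay_pow_apply]
  rw [Finset.sum_comm]
  refine Finset.sum_congr rfl fun j _ => ?_
  rw [← Finset.sum_range_reflect]
  refine Finset.sum_congr rfl fun k hk => ?_
  have hk' : k ≤ t := by simpa [Nat.lt_succ_iff] using hk
  have e1 : t + 1 - 1 - k = t - k := by omega
  have e2 : ¬ t < t - k := by omega
  have e3 : t - (t - k) = k := by omega
  rw [e1, if_neg e2, e3, mul_comm]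
  rfl

/-! ### Gains and `ℓ₁` norms -/

lemma enorm_le_supNorm_trunc {T t : ℕ} (h : t ≤ T) (x : Signal n) (i : Fin n) :
    ‖x t i‖ₑ ≤ supNorm (trunc T x) := by
  refine le_trans (le_of_eq ?_) (le_iSup₂ (f := fun t i => ‖trunc T x t i‖ₑ) t i)
  simp [trunc, h]

lemma supNorm_trunc_le {T : ℕ} {x : Signal n} {c : ℝ≥0∞}
    (h : ∀ t ≤ T, ∀ i, ‖x t i‖ₑ ≤ c) : supNorm (trunc T x) ≤ c := by
  refine iSup₂_le fun t i => ?_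
  by_cases ht : t ≤ T
  · simpa [trunc, ht] using h t ht i
  · simp [trunc, ht]

lemma gain_le {H : Op n} {c : ℝ≥0∞}
    (h : ∀ T x, ∀ t ≤ T, ∀ i, ‖H x t i‖ₑ ≤ c * supNorm (trunc T x)) : gain H ≤ c :=
  iSup_le fun T => iSup_le fun x => iSup_le fun _ =>
    ENNReal.div_le_of_le_mul (supNorm_trunc_le (h T x))

lemma gain_zero : gain (0 : Op n) = 0 :=
  le_antisymm (gain_le fun T x t _ i => by simp) (zero_le)

lemma supNorm_trunc_lt_top (T : ℕ) (x : Signal n) : supNorm (trunc T x) < ∞ := by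
  refine lt_of_le_of_lt (supNorm_trunc_le (c := ∑ t ∈ range (T + 1), ∑ i, ‖x t i‖ₑ) ?_) ?_
  · intro t ht i
    refine le_trans ?_ (Finset.single_le_sum (f := fun t => ∑ i, ‖x t i‖ₑ)
      (fun _ _ => zero_le) (Finset.mem_range.2 (Nat.lt_succ_of_le ht)))
    exact Finset.single_le_sum (f := fun i => ‖x t i‖ₑ) (fun _ _ => zero_le) (Finset.mem_univ i)
  · simp [ENNReal.sum_lt_top]

lemma enorm_apply_le {H : Op n} (hH : IsStable H) (x : Signal n) {t T : ℕ} (ht : t ≤ T)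
    (i : Fin n) : ‖H x t i‖ₑ ≤ gain H * supNorm (trunc T x) := by
  refine le_trans (enorm_le_supNorm_trunc ht _ _) ?_
  by_cases hx : x = 0
  · subst hx
    refine le_trans (supNorm_trunc_le (c := 0) fun t _ i => by simp) (zero_le)
  · have h : supNorm (trunc T (H x)) / supNorm (trunc T x) ≤ gain H :=
      le_trans (le_iSup (fun _ : x ≠ 0 => supNorm (trunc T (H x)) / supNorm (trunc T x)) hx)
        (le_iSup₂ (f := fun T x => ⨆ _ : x ≠ 0, supNorm (trunc T (H x)) / supNorm (trunc T x)) T x)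
    -- A finite gain rules out a nonzero value over `0`, and a truncated norm is never `∞`.
    exact (ENNReal.div_le_iff_le_mul (Or.inr hH.ne)
      (Or.inl (supNorm_trunc_lt_top T x).ne)).1 h

lemma abs_sign_le_one (a : ℝ) : |(SignType.sign a : ℝ)| ≤ 1 := by
  rcases lt_trichotomy a 0 with h | h | h <;> simp [h]

/-- The impulse responses of a stable causal time-invariant operator are absolutely summable. -/
lemma summable_impulseResponse {G : Op n} (hc : IsCausal G) (hti : IsTimeInvariant G)
    (hs : IsStable G) (i j : Fin n) : Summable fun k => |impulseResponse G i j k| := by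
  refine summable_of_sum_range_le (c := (gain G).toReal) (fun _ => abs_nonneg _) fun N => ?_
  rcases N with _ | T
  · simp
  -- Time-reversed signs make the output at time `T` the partial `ℓ₁` sum.
  let u : Signal n := fun s l =>
    if l = j then (SignType.sign (impulseResponse G i j (T - s)) : ℝ) else 0
  have h1 : G u T i = ∑ k ∈ range (T + 1), |impulseResponse G i j k| := by
    rw [apply_eq_convolution hc hti, Finset.sum_eq_single j]
    · refine Finset.sum_congr rfl fun k hk => ?_
      have hk' : k ≤ T := by simpa [Nat.lt_succ_iff] using hk
      have : T - (T - k) = k := by omega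
      simp [u, this]
    · intro l _ hl
      simp [u, hl]
    · simp
  have h2 : supNorm (trunc T u) ≤ 1 := by
    refine supNorm_trunc_le fun t _ l => ?_
    by_cases hl : l = j
    · simp only [u, if_pos hl, Real.enorm_eq_ofReal_abs]
      exact ENNReal.ofReal_le_one.2 (abs_sign_le_one _)
    · simp [u, hl]
  have h3 : ‖G u T i‖ₑ ≤ gain G :=
    (enorm_apply_le hs u le_rfl i).trans (mul_le_of_le_one_right' h2)
  rw [← h1]
  have h4 := ENNReal.toReal_mono hs.ne h3
  rw [toReal_enorm] at h4
  exact (le_abs_self _).trans h4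

/-- The induced norm of an entry is at most the `ℓ₁` norm of its impulse response. -/
lemma magnitudeMatrix_le_tsum {G : Op n} (hc : IsCausal G) (hti : IsTimeInvariant G)
    (hs : IsStable G) (i j : Fin n) :
    magnitudeMatrix G i j ≤ ∑' k, |impulseResponse G i j k| := by
  have hsum := summable_impulseResponse hc hti hs i j
  refine ENNReal.toReal_le_of_le_ofReal (tsum_nonneg fun _ => abs_nonneg _) ?_
  refine gain_le fun T u t ht l => ?_
  have h1 : entry G i j u t l
      = ∑ k ∈ range (t + 1), impulseResponse G i j k * u (t - k) 0 := by
    change G (channelIn j u) t i = _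
    rw [apply_eq_convolution hc hti, Finset.sum_eq_single j]
    · simp [channelIn]
    · intro l _ hl
      simp [channelIn, hl]
    · simp
  rw [h1]
  calc ‖∑ k ∈ range (t + 1), impulseResponse G i j k * u (t - k) 0‖ₑ
      ≤ ∑ k ∈ range (t + 1), ‖impulseResponse G i j k * u (t - k) 0‖ₑ := enorm_sum_le _ _
    _ ≤ ∑ k ∈ range (t + 1), ENNReal.ofReal |impulseResponse G i j k| * supNorm (trunc T u) := by
        refine Finset.sum_le_sum fun k _ => ?_
        rw [enorm_mul, ← Real.enorm_eq_ofReal_abs]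
        gcongr
        exact enorm_le_supNorm_trunc (by omega) u 0
    _ = ENNReal.ofReal (∑ k ∈ range (t + 1), |impulseResponse G i j k|)
          * supNorm (trunc T u) := by
        rw [← Finset.sum_mul, ENNReal.ofReal_sum_of_nonneg fun _ _ => abs_nonneg _]
    _ ≤ _ := by
        gcongr
        exact hsum.sum_le_tsum _ fun _ _ => abs_nonneg _

/-! ### Interpolation and instability -/

/-- Interpolation by a diagonal uncertainty: `y` is a diagonal causal image of `x` as soon as
each `y t i` is dominated by an earlier value of `x` in the same channel. -/
lemma exists_diagonal_interpolation {x y : Signal n} {c : ℝ} (hc : 0 ≤ c)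
    (h : ∀ t i, ∃ s ≤ t, |y t i| ≤ c * |x s i|) :
    ∃ Δ ∈ diagonalUncertainty n, Δ x = y ∧ (∀ i, gain (entry Δ i i) ≤ ENNReal.ofReal c) ∧
      ∀ i, (∀ t, y t i = 0) → gain (entry Δ i i) = 0 := by
  choose s hs hy using h
  -- Each output rescales one remembered sample. If that sample of `x` is `0`, the quotient is `0`,
  -- and domination forces `y t i = 0` as well.
  let Δ : Op n :=
    { toFun := fun u t i => y t i / x (s t i) i * u (s t i) i
      map_add' := fun u v => by funext t i; simp [mul_add]
      map_smul' := fun a u => by funext t i; simp; ring }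
  have hΔ : ∀ u t i, Δ u t i = y t i / x (s t i) i * u (s t i) i := fun _ _ _ => rfl
  have hq : ∀ t i, ‖y t i / x (s t i) i‖ₑ ≤ ENNReal.ofReal c := by
    intro t i
    rw [Real.enorm_eq_ofReal_abs, abs_div]
    exact ENNReal.ofReal_le_ofReal (div_le_of_le_mul₀ (abs_nonneg _) hc (hy t i))
  have hb : ∀ i, gain (entry Δ i i) ≤ ENNReal.ofReal c := by
    refine fun i => gain_le fun T u t ht l => ?_
    have : entry Δ i i u t l = y t i / x (s t i) i * u (s t i) 0 := by
      change Δ (channelIn i u) t i = _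
      rw [hΔ]
      simp [channelIn]
    rw [this, enorm_mul]
    gcongr
    · exact hq t i
    · exact enorm_le_supNorm_trunc ((hs t i).trans ht) u 0
  refine ⟨Δ, ⟨?_, ?_, ?_⟩, ?_, hb, ?_⟩
  · intro T
    ext u t i
    by_cases ht : t ≤ T
    · have : s t i ≤ T := (hs t i).trans ht
      simp [trunc, ht, hΔ, this]
    · simp [trunc, ht]
  · refine lt_of_le_of_lt (gain_le (c := ENNReal.ofReal c) fun T u t ht i => ?_)
      ENNReal.ofReal_lt_top
    rw [hΔ, enorm_mul]
    gcongr
    · exact hq t i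
    · exact enorm_le_supNorm_trunc ((hs t i).trans ht) u i
  · intro i j hij
    refine LinearMap.ext fun u => ?_
    funext t l
    change Δ (channelIn j u) t i = 0
    rw [hΔ]
    simp [channelIn, hij]
  · funext t i
    rw [hΔ]
    by_cases h0 : x (s t i) i = 0
    · have := hy t i
      rw [h0, abs_zero, mul_zero] at this
      rw [h0, mul_zero, abs_nonpos_iff.1 this]
    · exact div_mul_cancel₀ _ h0
  · intro i hi
    have : entry Δ i i = 0 := by
      refine LinearMap.ext fun u => ?_
      funext t l
      change Δ (channelIn i u) t i = 0
      rw [hΔ]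
      simp [hi]
    rw [this, gain_zero]

/-- A loop that maps an unbounded signal to a bounded one has no stable inverse. -/
lemma not_hasStableInverse {H : Op n} {x : Signal n} {c : ℝ≥0∞} (hc : c < ∞)
    (hb : ∀ t i, ‖H x t i‖ₑ ≤ c) (hx : ∀ C : ℝ, ∃ t i, C < |x t i|) :
    ¬ HasStableInverse H := by
  rintro ⟨K, -, hK, hKH, -⟩
  have h1 : K (H x) = x := LinearMap.congr_fun hKH x
  have hlt : gain K * c < ∞ := ENNReal.mul_lt_top hK hc
  obtain ⟨t, i, hti⟩ := hx (gain K * c).toReal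
  have h2 := enorm_apply_le hK (H x) (le_refl t) i
  rw [h1] at h2
  have h3 : ‖x t i‖ₑ ≤ gain K * c :=
    h2.trans (by gcongr; exact supNorm_trunc_le fun t _ i => hb t i)
  have h4 := ENNReal.toReal_mono hlt.ne h3
  rw [toReal_enorm] at h4
  exact absurd hti (not_lt.2 h4)

/-! ### Growing excitation -/

/-- A block length for which the head of every convolution dominates its tail. -/
lemma exists_block_length {g : Fin n → Fin n → ℕ → ℝ} (hg : ∀ i j, Summable fun k => |g i j k|)
    {v : Fin n → ℝ} {a b : ℝ} (hab : a < b)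
    (hM : ∀ i, b * v i ≤ ∑ j, (∑' k, |g i j k|) * v j) :
    ∃ N, 2 ≤ N ∧ ∀ i, 0 < v i →
      a * v i ≤ ∑ j, (2 * ∑ k ∈ range N, |g i j k| - ∑' k, |g i j k|) * v j := by
  -- Twice the head minus the total is head minus tail, which tends to the full `ℓ₁` norm.
  have h : ∀ i, ∀ᶠ N in atTop, 0 < v i →
      a * v i ≤ ∑ j, (2 * ∑ k ∈ range N, |g i j k| - ∑' k, |g i j k|) * v j := by
    intro i
    by_cases hv : 0 < v i
    · have ht : Tendsto (fun N => ∑ j, (2 * ∑ k ∈ range N, |g i j k| - ∑' k, |g i j k|) * v j)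
          atTop (nhds (∑ j, (2 * (∑' k, |g i j k|) - ∑' k, |g i j k|) * v j)) :=
        tendsto_finsetSum _ fun j _ =>
          (((hg i j).hasSum.tendsto_sum_nat.const_mul 2).sub_const _).mul_const _
      have hlt : a * v i < ∑ j, (2 * (∑' k, |g i j k|) - ∑' k, |g i j k|) * v j := by
        refine lt_of_lt_of_le (mul_lt_mul_of_pos_right hab hv) ((hM i).trans (le_of_eq ?_))
        exact Finset.sum_congr rfl fun j _ => by ring
      filter_upwards [ht.eventually_const_lt hlt] with N hN _ using hN.le
    · exact Eventually.of_forall fun N h => absurd h hv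
  exact ((eventually_ge_atTop 2).and (eventually_all.2 h)).exists

/-- Block-wise sign-matched excitation: it grows geometrically from one round of blocks to the
next, and the response of each channel `i` at the end of its block is at least `a` times
the current amplitude. -/
lemma exists_growing_excitation [NeZero n] {g : Fin n → Fin n → ℕ → ℝ}
    (hg : ∀ i j, Summable fun k => |g i j k|)
    {v : Fin n → ℝ} (hv : ∀ i, 0 ≤ v i) {a θ : ℝ} (hθ : 1 ≤ θ) {N : ℕ} (hN : 2 ≤ N)
    (hM : ∀ i, 0 < v i →
      a * v i ≤ ∑ j, (2 * ∑ k ∈ range N, |g i j k| - ∑' k, |g i j k|) * v j) :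
    ∃ y : Signal n, (∀ t i, |y t i| ≤ θ ^ (t / (N * n)) * v i) ∧
      ∀ p i, 0 < v i → ∃ s, 0 < s ∧ s < N * n * (p + 1) ∧
        θ ^ p * (a * v i) ≤ ∑ j, ∑ k ∈ range (s + 1), g i j k * y (s - k) j := by
  have hn : 0 < n := Nat.pos_of_ne_zero (NeZero.ne n)
  let ch : ℕ → Fin n := fun b => ⟨b % n, Nat.mod_lt _ hn⟩
  -- Block `t / N` serves channel `t / N` mod `n`; a round is `n` blocks.
  let y : Signal n := fun t j => θ ^ (t / (N * n)) * v j *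
    (SignType.sign (g (ch (t / N)) j (N - 1 - t % N)) : ℝ)
  have hy : ∀ t i, |y t i| ≤ θ ^ (t / (N * n)) * v i := by
    intro t i
    have h0 : 0 ≤ θ ^ (t / (N * n)) * v i := mul_nonneg (by positivity) (hv i)
    simp only [y]
    rw [abs_mul, abs_of_nonneg h0]
    exact mul_le_of_le_one_right h0 (abs_sign_le_one _)
  refine ⟨y, hy, fun p i hi => ?_⟩
  set b := p * n + i.val with hb
  set s := b * N + (N - 1) with hsdef
  have hbn : b + 1 ≤ n * (p + 1) := by
    have := i.isLt
    rw [hb]; nlinarith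
  have hs1 : s < N * n * (p + 1) := by
    have : (b + 1) * N ≤ n * (p + 1) * N := Nat.mul_le_mul_right _ hbn
    have e : n * (p + 1) * N = N * n * (p + 1) := by ring
    have e2 : (b + 1) * N = b * N + N := by ring
    omega
  have hchb : ch b = i := by
    apply Fin.ext
    simp [ch, hb, Nat.add_mod, Nat.mod_eq_of_lt i.isLt]
  have hbp : b / n = p := by
    rw [hb, Nat.mul_comm, Nat.mul_add_div hn, Nat.div_eq_of_lt i.isLt, add_zero]
  have hin : ∀ k < N, ∀ j, y (s - k) j = θ ^ p * v j * (SignType.sign (g i j k) : ℝ) := by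
    intro k hk j
    have e : s - k = N * b + (N - 1 - k) := by
      rw [hsdef, Nat.mul_comm]; omega
    have e1 : (s - k) / N = b := by
      rw [e, Nat.mul_add_div (by omega), Nat.div_eq_of_lt (by omega), add_zero]
    have e2 : (s - k) % N = N - 1 - k := by
      rw [e, Nat.mul_add_mod, Nat.mod_eq_of_lt (by omega)]
    have e3 : N - 1 - (N - 1 - k) = k := by omega
    simp only [y]
    rw [← Nat.div_div_eq_div_mul, e1, e2, e3, hbp, hchb]
  -- As `θ ≥ 1`, no earlier input exceeds the amplitude of round `p`; this bounds the tail.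
  have hout : ∀ k j, |y (s - k) j| ≤ θ ^ p * v j := by
    intro k j
    refine (hy _ _).trans (mul_le_mul_of_nonneg_right (pow_le_pow_right₀ hθ ?_) (hv j))
    refine Nat.le_of_lt_succ (Nat.div_lt_of_lt_mul ?_)
    exact lt_of_le_of_lt (Nat.sub_le _ _) hs1
  -- `2 ≤ N` keeps `s` away from time 0, which is reserved for the seed.
  refine ⟨s, by omega, hs1, ?_⟩
  calc θ ^ p * (a * v i)
      ≤ θ ^ p * ∑ j, (2 * ∑ k ∈ range N, |g i j k| - ∑' k, |g i j k|) * v j :=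
        mul_le_mul_of_nonneg_left (hM i hi) (by positivity)
    _ = ∑ j, θ ^ p * v j * (2 * ∑ k ∈ range N, |g i j k| - ∑' k, |g i j k|) := by
        rw [Finset.mul_sum]
        exact Finset.sum_congr rfl fun j _ => by ring
    _ ≤ _ := by
        refine Finset.sum_le_sum fun j _ => ?_
        have hNs : N ≤ s + 1 := by omega
        have hA : 0 ≤ θ ^ p * v j := mul_nonneg (by positivity) (hv j)
        rw [← Finset.sum_range_add_sum_Ico _ hNs]
        have h1 : ∑ k ∈ range N, g i j k * y (s - k) j
            = θ ^ p * v j * ∑ k ∈ range N, |g i j k| := by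
          rw [Finset.mul_sum]
          refine Finset.sum_congr rfl fun k hk => ?_
          rw [hin k (Finset.mem_range.1 hk), ← self_mul_sign]
          ring
        have h2 : -(θ ^ p * v j * ∑ k ∈ Ico N (s + 1), |g i j k|)
            ≤ ∑ k ∈ Ico N (s + 1), g i j k * y (s - k) j := by
          rw [Finset.mul_sum, ← Finset.sum_neg_distrib]
          refine Finset.sum_le_sum fun k _ => ?_
          refine (neg_le_neg ?_).trans (neg_abs_le _)
          rw [abs_mul, mul_comm]
          exact mul_le_mul_of_nonneg_right (hout k j) (abs_nonneg _)
        have h3 : ∑ k ∈ range N, |g i j k| + ∑ k ∈ Ico N (s + 1), |g i j k|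
            ≤ ∑' k, |g i j k| := by
          rw [Finset.sum_range_add_sum_Ico _ hNs]
          exact (hg i j).sum_le_tsum _ fun _ _ => abs_nonneg _
        have h4 := mul_le_mul_of_nonneg_left h3 hA
        rw [h1]
        linarith

/-! ### Destabilizing uncertainty -/

/-- The absolute value of an eigenvector is a subinvariant vector of a nonnegative matrix. -/
lemma exists_subinvariant_vector {m : ℕ} {A : Matrix (Fin m) (Fin m) ℝ} (hA : ∀ i j, 0 ≤ A i j)
    {r : ℝ≥0∞} (hr : r < rho A) :
    ∃ (b : ℝ) (w : Fin m → ℝ), r < ENNReal.ofReal b ∧ (∀ i, 0 ≤ w i) ∧ w ≠ 0 ∧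
      ∀ i, b * w i ≤ ∑ j, A i j * w j := by
  unfold rho spectralRadius at hr
  obtain ⟨z, hr⟩ := lt_iSup_iff.1 hr
  obtain ⟨hz, hr⟩ := lt_iSup_iff.1 hr
  rw [← Matrix.spectrum_toLin', ← Module.End.hasEigenvalue_iff_mem_spectrum] at hz
  obtain ⟨w, hw⟩ := hz.exists_hasEigenvector
  refine ⟨‖z‖, fun i => ‖w i‖, ?_, fun i => norm_nonneg _, ?_, fun i => ?_⟩
  · rwa [ofReal_norm, enorm_eq_nnnorm]
  · intro h
    exact hw.2 (funext fun i => norm_eq_zero.1 (congrFun h i))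
  · have h1 := congrFun hw.apply_eq_smul i
    rw [Matrix.toLin'_apply, Pi.smul_apply, smul_eq_mul] at h1
    rw [← norm_mul, ← h1]
    refine (norm_sum_le univ fun j => (A.map (fun a => (a : ℂ))) i j * w j).trans
      (le_of_eq (Finset.sum_congr rfl fun j _ => ?_))
    simp [abs_of_nonneg (hA i j)]

/-- A subinvariant vector of the magnitude matrix yields a destabilizing diagonal uncertainty
acting on its support only. -/
lemma exists_destabilizing {G : Op n} (hc : IsCausal G) (hti : IsTimeInvariant G)
    (hs : IsStable G) {v : Fin n → ℝ} (hv : ∀ i, 0 ≤ v i) (hv0 : v ≠ 0) {r b : ℝ} (hr : 0 < r)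
    (hrb : r < b) (hM : ∀ i, 0 < v i → b * v i ≤ ∑ j, magnitudeMatrix G i j * v j) :
    ∃ Δ ∈ diagonalUncertainty n, ¬ HasStableInverse (LinearMap.id - G ∘ₗ Δ) ∧
      (∀ i, gain (entry Δ i i) ≤ ENNReal.ofReal r⁻¹) ∧
      ∀ i, v i = 0 → gain (entry Δ i i) = 0 := by
  obtain ⟨i₀, hi₀⟩ : ∃ i, v i ≠ 0 := Function.ne_iff.1 hv0
  have hi₀ : 0 < v i₀ := lt_of_le_of_ne (hv i₀) hi₀.symm
  have : NeZero n := ⟨fun h => by subst h; exact i₀.elim0⟩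
  have hg := summable_impulseResponse hc hti hs
  -- The gap `a < b` absorbs the tails; the gap `r < a` gives growth.
  obtain ⟨a, hra, hab⟩ := exists_between hrb
  obtain ⟨N, hN, hNM⟩ := exists_block_length hg hab (v := v) fun i => by
    rcases (hv i).eq_or_lt with h | h
    · rw [← h, mul_zero]
      exact Finset.sum_nonneg fun j _ =>
        mul_nonneg (tsum_nonneg fun _ => abs_nonneg _) (hv j)
    · exact (hM i h).trans (Finset.sum_le_sum fun j _ =>
        mul_le_mul_of_nonneg_right (magnitudeMatrix_le_tsum hc hti hs i j) (hv j))
  have hθ : 1 < a / r := (one_lt_div hr).2 hra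
  obtain ⟨y, hy, hresp⟩ := exists_growing_excitation hg hv hθ.le hN hNM
  let x : Signal n := fun t i => if t = 0 then r * v i else G y t i
  have hgrow : ∀ p i, 0 < v i → ∃ s, s < N * n * (p + 1) ∧
      (a / r) ^ (p + 1) * v i ≤ r⁻¹ * |x s i| := by
    intro p i hi
    obtain ⟨s, hs0, hs1, hs2⟩ := hresp p i hi
    refine ⟨s, hs1, ?_⟩
    rw [← apply_eq_convolution hc hti] at hs2
    have e : x s i = G y s i := if_neg hs0.ne'
    rw [e]
    calc (a / r) ^ (p + 1) * v i = r⁻¹ * ((a / r) ^ p * (a * v i)) := by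
          rw [pow_succ]; field_simp
      _ ≤ r⁻¹ * |G y s i| := by
          gcongr
          exact hs2.trans (le_abs_self _)
  have hdom : ∀ t i, ∃ s ≤ t, |y t i| ≤ r⁻¹ * |x s i| := by
    intro t i
    have hyt := hy t i
    rcases (hv i).eq_or_lt with h | h
    · refine ⟨0, Nat.zero_le _, ?_⟩
      rw [← h, mul_zero] at hyt
      exact hyt.trans (by positivity)
    · rcases hp : t / (N * n) with _ | p
      -- Round 0 draws on the seed `r * v i`; later rounds draw on responses from before they start.
      · refine ⟨0, Nat.zero_le _, ?_⟩
        rw [hp, pow_zero, one_mul] at hyt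
        have e : x 0 i = r * v i := if_pos rfl
        rw [e, abs_of_pos (mul_pos hr h), inv_mul_cancel_left₀ hr.ne']
        exact hyt
      · obtain ⟨s, hs1, hs2⟩ := hgrow p i h
        rw [hp] at hyt
        refine ⟨s, ?_, hyt.trans hs2⟩
        have := Nat.mul_div_le t (N * n)
        rw [hp] at this
        omega
  obtain ⟨Δ, hΔ, hΔx, hΔg, hΔ0⟩ := exists_diagonal_interpolation (inv_pos.2 hr).le hdom
  refine ⟨Δ, hΔ, ?_, hΔg, fun i hi => hΔ0 i fun t => ?_⟩
  · have hd : ∀ t i, (LinearMap.id - G ∘ₗ Δ : Op n) x t i = x t i - G y t i := by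
      intro t i
      rw [← hΔx]
      rfl
    refine not_hasStableInverse (x := x) (supNorm_trunc_lt_top 0 ((LinearMap.id - G ∘ₗ Δ : Op n) x))
      (fun t i => ?_) fun C => ?_
    · rcases Nat.eq_zero_or_pos t with h | h
      · subst h
        exact enorm_le_supNorm_trunc le_rfl _ _
      · have e : x t i = G y t i := if_neg h.ne'
        rw [hd, e, sub_self, enorm_zero]
        exact zero_le
    · obtain ⟨p, hp⟩ := pow_unbounded_of_one_lt (r⁻¹ * C / v i₀) hθ
      obtain ⟨s, -, hs2⟩ := hgrow p i₀ hi₀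
      refine ⟨s, i₀, lt_of_mul_lt_mul_left (lt_of_lt_of_le ?_ hs2) (inv_pos.2 hr).le⟩
      rw [div_lt_iff₀ hi₀] at hp
      refine hp.trans_le (mul_le_mul_of_nonneg_right ?_ hi₀.le)
      exact pow_le_pow_right₀ hθ.le (Nat.le_succ p)
  · have := hy t i
    rw [hi, mul_zero] at this
    exact abs_nonpos_iff.1 this

end RobustNu

theorem mainTheorem4 (n : ℕ) (G : RobustNu.Op n)
    (hcausal : RobustNu.IsCausal G) (hti : RobustNu.IsTimeInvariant G)
    (hstable : RobustNu.IsStable G)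
    (m : ℕ) (hm : 1 ≤ m) (I : Fin m → Fin n) (hI : Function.Injective I) :
    RobustNu.nu G ≥
      RobustNu.rho ((RobustNu.magnitudeMatrix G).submatrix I I) / (m : ENNReal) := by
  refine ENNReal.div_le_of_le_mul (ENNReal.le_of_forall_nnreal_lt fun r hr => ?_)
  rcases eq_or_ne r 0 with rfl | hr0
  · simp
  have hrpos : (0 : ℝ) < r := by positivity
  obtain ⟨b, w, hrb, hw, hw0, hM⟩ :=
    RobustNu.exists_subinvariant_vector (fun _ _ => ENNReal.toReal_nonneg) hr
  have hrb' : (r : ℝ) < b := by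
    rw [← ENNReal.ofReal_coe_nnreal] at hrb
    exact (ENNReal.ofReal_lt_ofReal_iff_of_nonneg hrpos.le).1 hrb
  let v : Fin n → ℝ := Function.extend I w (fun _ => 0)
  have hvI : ∀ k, v (I k) = w k := fun k => hI.extend_apply w _ k
  have hvout : ∀ i, i ∉ Set.range I → v i = 0 := fun i hi => Function.extend_apply' w _ i hi
  have hv : ∀ i, 0 ≤ v i := by
    intro i
    by_cases hi : i ∈ Set.range I
    · obtain ⟨k, rfl⟩ := hi
      rw [hvI]; exact hw k
    · rw [hvout i hi]
  have hv0 : v ≠ 0 := by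
    intro h
    refine hw0 (funext fun k => ?_)
    rw [← hvI, h]; rfl
  obtain ⟨Δ, hΔ, hinv, hgain, hzero⟩ := RobustNu.exists_destabilizing hcausal hti hstable hv hv0
    hrpos hrb' fun i hi => by
      have hex : i ∈ Set.range I := by
        by_contra h
        exact hi.ne' (hvout i h)
      obtain ⟨k, rfl⟩ := hex
      rw [hvI]
      refine (hM k).trans (le_of_eq ?_)
      refine Fintype.sum_of_injective I hI _ _ (fun j hj => ?_) fun l => ?_
      · rw [hvout j hj, mul_zero]
      · rw [hvI]; rfl
  -- Channels outside `I` have gain zero, so the factor is `m`, not `n`.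
  have hsum : ∑ i, RobustNu.gain (RobustNu.entry Δ i i) ≤ m * (r : ENNReal)⁻¹ := by
    rw [← Fintype.sum_of_injective I hI (fun k => RobustNu.gain (RobustNu.entry Δ (I k) (I k))) _
      (fun i hi => hzero i (hvout i hi)) fun _ => rfl]
    refine (Finset.sum_le_card_nsmul _ _ _ fun k _ => hgain (I k)).trans (le_of_eq ?_)
    rw [ENNReal.ofReal_inv_of_pos hrpos, ENNReal.ofReal_coe_nnreal]
    simp
  have hinf := (iInf₂_le Δ ⟨hΔ, hinv⟩ (f := fun Δ (_ : Δ ∈ {Δ ∈ RobustNu.diagonalUncertainty n |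
    ¬ RobustNu.HasStableInverse (LinearMap.id - G ∘ₗ Δ)}) =>
      ∑ i, RobustNu.gain (RobustNu.entry Δ i i))).trans hsum
  have hm0 : (m : ENNReal) ≠ 0 := by
    exact_mod_cast (Nat.one_le_iff_ne_zero.1 hm)
  calc (r : ENNReal) = 1 / (m * (r : ENNReal)⁻¹) * m := by
        rw [one_div, ENNReal.mul_inv (Or.inl hm0) (Or.inl (ENNReal.natCast_ne_top m)), inv_inv,
          mul_right_comm, ENNReal.inv_mul_cancel hm0 (ENNReal.natCast_ne_top m), one_mul]
    _ ≤ RobustNu.nu G * m := mul_le_mul_left (ENNReal.div_le_div_left hinf 1) _
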